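/- For $\mu\in\mathbb R$ and a pair $\boldsymbol\rho=(\rho_1,\rho_2)$ of functions on $\mathbb R$, let $(S^df)(x)=f(x+d)$, $A=S^1+S^{-1}$, $\delta=S^1-S^{-1}$, \[ \mathcal D_\mu=\frac12\begin{bmatrix}(2+\mu)(2-A)&\mu\delta\\-\mu\delta&(2+\mu)(2+A)\end{bmatrix},\qquad \mathcal Q(\boldsymbol\rho,\boldsymbol\rho)=\begin{pmatrix}\rho_1^2+\rho_2^2\\2\rho_1\rho_2\end{pmatrix}, \] and let $\mathcal G_c(\boldsymbol\rho,\mu)=c^2\boldsymbol\rho''+\mathcal D_\mu\boldsymbol\rho+\mathcal D_\mu\mathcal Q(\boldsymbol\rho,\boldsymbol\rho)$ (the traveling-wave operator with wave speed $c$ of the diatomic FPUT lattice with mass ratio $1/m=1+\mu$). Put $\lambda_\mu^+(K)=2+\mu+\sqrt{\mu^2+4(1+\mu)\cos^2K}$. Let $|c|>1$. There is a number $\mu_\omega(c)>0$ such that for every $|\mu|\le\mu_\omega(c)$ there is a unique $\omega_c^\mu>0$ with $c^2(\omega_c^\mu)^2=\lambda_\mu^+(\omega_c^\mu)$. For any such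 $\mu_\omega(c)$ there are $\mu_{\mathrm{per}}(c)\in(0,\min\{\mu_\omega(c),1\})$ and $a_{\mathrm{per}}(c)>0$ such that for all $|\mu|\le\mu_{\mathrm{per}}(c)$ the number \[ \upsilon_c^\mu:=\frac{\mu\sin(\omega_c^\mu)}{\lambda_\mu^+(\omega_c^\mu)-(2+\mu)(1-\cos(\omega_c^\mu))} \] is well defined (the denominator is nonzero) with $|\upsilon_c^\mu|\le C(c)|\mu|$, and there are maps $a\mapsto\omega_c^\mu[a]\in\mathbb R$, $a\mapsto\psi_{c,1}^\mu[a]$ and $a\mapsto\psi_{c,2}^\mu[a]$ on $[-a_{\mathrm{per}}(c),a_{\mathrm{per}}(c)]$, where $\psi_{c,1}^\mu[a]$ is an even and $\psi_{c,2}^\mu[a]$ an odd real-valued, $2\pi$-periodic $C^\infty$ function on $\mathbb R$, with the following properties. (i) If \[ \boldsymbol\phi_c^\mu[a](x)=\begin{pmatrix}\upsilon_c^\mu\cos(\omega_c^\mu[a]x)\\ \sin(\omega_c^\mu[a]x)\end{pmatrix}+\begin{pmatrix}\psi_{c,1}^\mu[a](\omega_c^\mu[a]x)\\ \psi_{c,2}^\mu[a](\omega_c^\mu[a]x)\end{pmatrix},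 \] then $\mathcal G_c(a\boldsymbol\phi_c^\mu[a],\mu)=0$ on $\mathbb R$ for all $|a|\le a_{\mathrm{per}}(c)$. (ii) $\omega_c^\mu[0]=\omega_c^\mu$. (iii) $\psi_{c,1}^\mu[0]=\psi_{c,2}^\mu[0]=0$. (iv) For each integer $r\ge0$ there is $C(c,r)>0$ such that for all $|a|,|\grave a|\le a_{\mathrm{per}}(c)$ and all $|\mu|\le\mu_{\mathrm{per}}(c)$, \[ |\omega_c^\mu[a]-\omega_c^\mu[\grave a]|+\|\psi_{c,1}^\mu[a]-\psi_{c,1}^\mu[\grave a]\|_{W^{r,\infty}(\mathbb R)}+\|\psi_{c,2}^\mu[a]-\psi_{c,2}^\mu[\grave a]\|_{W^{r,\infty}(\mathbb R)}\le C(c,r)|a-\grave a|. \] -/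

import Mathlib

noncomputable section

namespace DiatomicFPUT

/-- Pairs `(ρ₁, ρ₂)` of real-valued profile functions on the line. -/
abbrev Profile := (ℝ → ℝ) × (ℝ → ℝ)

/-- The shift operator `(S^d f)(x) = f(x + d)`. -/
def shift (d : ℝ) (f : ℝ → ℝ) : ℝ → ℝ := fun x => f (x + d)

/-- `A = S^1 + S^{-1}`. -/
def opA (f : ℝ → ℝ) : ℝ → ℝ := shift 1 f + shift (-1) f

/-- `δ = S^1 - S^{-1}`. -/
def opDelta (f : ℝ → ℝ) : ℝ → ℝ := shift 1 f - shift (-1) f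

/-- The operator `D_μ`, i.e. one half of the operator matrix with rows
`(2+μ)(2-A), μδ` and `-μδ, (2+μ)(2+A)`. -/
def opD (μ : ℝ) (ρ : Profile) : Profile :=
  ((1 / 2 : ℝ) • ((2 + μ) • ((2 : ℝ) • ρ.1 - opA ρ.1) + μ • opDelta ρ.2),
   (1 / 2 : ℝ) • (-(μ • opDelta ρ.1) + (2 + μ) • ((2 : ℝ) • ρ.2 + opA ρ.2)))

/-- The symmetric bilinear map `Q(ρ, σ) = (ρ₁σ₁ + ρ₂σ₂, ρ₁σ₂ + σ₁ρ₂)`. -/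
def nonlin (ρ σ : Profile) : Profile :=
  (ρ.1 * σ.1 + ρ.2 * σ.2, ρ.1 * σ.2 + σ.1 * ρ.2)

/-- The second derivative, componentwise. -/
def secondDeriv (ρ : Profile) : Profile := (iteratedDeriv 2 ρ.1, iteratedDeriv 2 ρ.2)

/-- The traveling wave operator `G_c(ρ, μ) = c²ρ'' + D_μ ρ + D_μ Q(ρ, ρ)`. -/
def travelingWaveOp (c : ℝ) (ρ : Profile) (μ : ℝ) : Profile :=
  c ^ 2 • secondDeriv ρ + opD μ ρ + opD μ (nonlin ρ ρ)

/-- The eigenvalue curve `λ_μ^+(K) = 2 + μ + √(μ² + 4(1+μ)cos²K)`. -/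
def lambdaPlus (μ K : ℝ) : ℝ :=
  2 + μ + Real.sqrt (μ ^ 2 + 4 * (1 + μ) * Real.cos K ^ 2)

/-- `ω` is a positive solution of `c²ω² = λ_μ^+(ω)`. -/
def IsCriticalFrequency (c μ ω : ℝ) : Prop :=
  0 < ω ∧ c ^ 2 * ω ^ 2 = lambdaPlus μ ω

/-- `μω > 0` is a threshold below which the critical frequency exists and is unique. -/
def IsFrequencyThreshold (c μω : ℝ) : Prop :=
  0 < μω ∧ ∀ μ : ℝ, |μ| ≤ μω → ∃! ω : ℝ, IsCriticalFrequency c μ ω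

/-- The critical frequency `ω_c^μ`. It is only used below a frequency threshold, where the set
on the right consists of exactly one point. -/
def criticalFrequency (c μ : ℝ) : ℝ := sInf {ω : ℝ | IsCriticalFrequency c μ ω}

/-- The denominator `λ_μ^+(ω_c^μ) - (2+μ)(1 - cos ω_c^μ)` in the definition of `υ_c^μ`. -/
def upsilonDenom (c μ : ℝ) : ℝ :=
  lambdaPlus μ (criticalFrequency c μ) - (2 + μ) * (1 - Real.cos (criticalFrequency c μ))

/-- The coefficient `υ_c^μ` of the leading order profile. -/
def upsilon (c μ : ℝ) : ℝ :=
  μ * Real.sin (criticalFrequency c μ) / upsilonDenom c μ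

/-- Membership in `C_per^∞`: smooth and `2π`-periodic. -/
def IsSmoothPeriodic (f : ℝ → ℝ) : Prop :=
  ContDiff ℝ ((⊤ : ℕ∞) : WithTop ℕ∞) f ∧ Function.Periodic f (2 * Real.pi)

/-- The `W^{r,∞}(ℝ)` norm of a smooth function (for which weak and classical derivatives agree),
with values in `[0, ∞]`. -/
def sobolevInftyNorm (r : ℕ) (f : ℝ → ℝ) : ENNReal :=
  ∑ k ∈ Finset.range (r + 1),
    MeasureTheory.eLpNorm (iteratedDeriv k f) ⊤ MeasureTheory.volume

/-- The profile `x ↦ (υ cos(ωx) + ψ₁(ωx), sin(ωx) + ψ₂(ωx))`. -/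
def periodicProfile (υ ω : ℝ) (ψ₁ ψ₂ : ℝ → ℝ) : Profile :=
  (fun x => υ * Real.cos (ω * x) + ψ₁ (ω * x), fun x => Real.sin (ω * x) + ψ₂ (ω * x))

end DiatomicFPUT

end

/-!
Write `ρ₁ + iρ₂` as a Fourier series in `y = ωx`. For even `ρ₁` and odd `ρ₂` its coefficients are
real; take them in an exponentially weighted `ℓ¹(ℤ)`, a Banach algebra all of whose elements are
smooth. For `ρ = a u` the equation `G_c(ρ, μ) = 0` becomes `u = B(μ, ω)(u + a Q(u, u))` with
`B = -c⁻² ∂⁻² D_μ`; applying `∂⁻²` makes `B` continuously differentiable in `ω` in operator norm.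

Fix the sine coefficient of `u` to be `1`. At `μ = a = 0` the solution is `(0, sin)`, with frequency
given by `c²ω² = 2 + 2 cos ω`. The eigenvalue `(2 + 2 cos ω) / (c²ω²)` of `B` crosses `1` with
nonzero speed and `B` is a contraction off its eigenvector, so the implicit function theorem yields
a Lipschitz branch `(μ, a) ↦ (ω, u)`, uniform in `μ`. For `a = 0` only the modes `±1` of `u`
survive; their `2 × 2` system says that `ω` is the critical frequency and that
`u = (υ cos, sin)`.
-/

noncomputable section

namespace DiatomicFPUT

open scoped lp NNReal ComplexConjugate

section SummableFamilies

variable {ι 𝕜 F : Type*} [NontriviallyNormedField 𝕜] [NormedAddCommGroup F] [NormedSpace 𝕜 F]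

/-- The coordinate functionals of `ℓ¹`. -/
def coord (i : ι) : ℓ¹(ι, 𝕜) →L[𝕜] 𝕜 := lp.evalCLM 𝕜 _ 1 i

@[simp]
lemma coord_apply (i : ι) (p : ℓ¹(ι, 𝕜)) : coord i p = p i := rfl

lemma hasSum_norm_apply (p : ℓ¹(ι, 𝕜)) : HasSum (fun i => ‖p i‖) ‖p‖ := by
  simpa only [ENNReal.toReal_one, Real.rpow_one] using
    lp.hasSum_norm (by simp only [ENNReal.toReal_one, one_pos]) p

variable [DecidableEq ι]

/-- The unit vectors of `ℓ¹`. -/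
def basisVec (i : ι) : ℓ¹(ι, 𝕜) := lp.single 1 i 1

lemma norm_basisVec (i : ι) : ‖(basisVec i : ℓ¹(ι, 𝕜))‖ = 1 := by
  rw [basisVec, lp.norm_single one_pos, norm_one]

lemma basisVec_apply (i j : ι) : (basisVec i : ℓ¹(ι, 𝕜)) j = if j = i then 1 else 0 := by
  rw [basisVec, lp.single_apply, Pi.single_apply]

lemma hasSum_smul_basisVec (p : ℓ¹(ι, 𝕜)) : HasSum (fun i => p i • basisVec i) p := by
  simpa only [basisVec, ← lp.single_smul, smul_eq_mul, mul_one] using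
    lp.hasSum_single ENNReal.one_ne_top p

lemma clm_ext_basisVec {S T : ℓ¹(ι, 𝕜) →L[𝕜] F} (h : ∀ i, S (basisVec i) = T (basisVec i)) :
    S = T :=
  lp.ext_continuousLinearMap ENNReal.one_ne_top fun i => ContinuousLinearMap.ext_ring (h i)

lemma opNorm_le_of_basisVec (T : ℓ¹(ι, 𝕜) →L[𝕜] F) {C : ℝ} (hC : 0 ≤ C)
    (h : ∀ i, ‖T (basisVec i)‖ ≤ C) : ‖T‖ ≤ C := by
  refine T.opNorm_le_bound hC fun p => ?_
  rw [← ((hasSum_smul_basisVec p).mapL T).tsum_eq]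
  refine tsum_of_norm_bounded ((hasSum_norm_apply p).mul_left C) fun i => ?_
  rw [map_smul, norm_smul, mul_comm]
  exact mul_le_mul_of_nonneg_right (h i) (norm_nonneg _)

variable [CompleteSpace F]

/-- The continuous linear map on `ℓ¹` sending the unit vectors to a given bounded family. -/
def lift (v : ι → F) (hv : ∃ C, ∀ i, ‖v i‖ ≤ C) : ℓ¹(ι, 𝕜) →L[𝕜] F :=
  lp.tsumCLM 𝕜 ι F ∘L lp.mapCLM 1 (fun i => ContinuousLinearMap.toSpanSingleton 𝕜 (v i))
    (K := max hv.choose 0) (le_max_right _ _) fun i => by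
      rw [ContinuousLinearMap.norm_toSpanSingleton]
      exact (hv.choose_spec i).trans (le_max_left _ _)

@[simp]
lemma lift_basisVec (v : ι → F) (hv : ∃ C, ∀ i, ‖v i‖ ≤ C) (i : ι) :
    lift (𝕜 := 𝕜) v hv (basisVec i) = v i := by
  rw [lift, ContinuousLinearMap.comp_apply, lp.tsumCLM_apply, tsum_eq_single i fun j hj => ?_]
  · simp [basisVec_apply]
  · simp [basisVec_apply, hj]

end SummableFamilies

section DifferentiableFamilies

variable {ι F : Type*} [NormedAddCommGroup F] [NormedSpace ℝ F]

lemma norm_sub_sub_smul_le_of_lipschitzWith_deriv {f f' : ℝ → F} {C : ℝ≥0}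
    (hf : ∀ t, HasDerivAt f (f' t) t) (hf' : LipschitzWith C f') (s t : ℝ) :
    ‖f s - f t - (s - t) • f' t‖ ≤ C * ‖s - t‖ ^ 2 := by
  have hd : ∀ r ∈ Set.uIcc t s,
      HasDerivWithinAt (fun r => f r - r • f' t) (f' r - f' t) (Set.uIcc t s) r := fun r _ => by
    simpa only [one_smul] using
      ((hf r).fun_sub ((hasDerivAt_id' r).smul_const (f' t))).hasDerivWithinAt
  have hb : ∀ r ∈ Set.uIcc t s, ‖f' r - f' t‖ ≤ C * ‖s - t‖ := fun r hr =>
    (hf'.norm_sub_le r t).trans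
      (mul_le_mul_of_nonneg_left (Set.abs_sub_left_of_mem_uIcc hr) C.coe_nonneg)
  have := (convex_uIcc t s).norm_image_sub_le_of_norm_hasDerivWithin_le hd hb
    Set.left_mem_uIcc Set.right_mem_uIcc
  rw [sq, ← mul_assoc]
  convert this using 2
  module

variable [CompleteSpace F] {v v' : ℝ → ι → F} {C : ℝ≥0}

lemma lipschitzWith_lift (hv : ∀ t, ∃ C, ∀ i, ‖v t i‖ ≤ C)
    (hC : ∀ i, LipschitzWith C fun t => v t i) :
    LipschitzWith C fun t => lift (𝕜 := ℝ) (v t) (hv t) :=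
  LipschitzWith.of_dist_le_mul fun s t => by
    classical
    rw [dist_eq_norm]
    refine opNorm_le_of_basisVec _ (by positivity) fun i => ?_
    rw [sub_apply, lift_basisVec, lift_basisVec, ← dist_eq_norm]
    exact (hC i).dist_le_mul s t

/-- The mean value inequality makes the difference quotients converge uniformly over the family,
that is, in operator norm. -/
lemma hasDerivAt_lift (hv : ∀ t, ∃ C, ∀ i, ‖v t i‖ ≤ C) (hv' : ∀ t, ∃ C, ∀ i, ‖v' t i‖ ≤ C)
    (hd : ∀ i t, HasDerivAt (fun s => v s i) (v' t i) t)
    (hC : ∀ i, LipschitzWith C fun t => v' t i) (t : ℝ) :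
    HasDerivAt (fun s => lift (𝕜 := ℝ) (v s) (hv s)) (lift (v' t) (hv' t)) t := by
  classical
  rw [hasDerivAt_iff_isLittleO]
  refine (Asymptotics.IsBigO.of_bound C (g := fun s => ‖s - t‖ ^ 2)
    (Filter.Eventually.of_forall fun s => ?_)).trans_isLittleO
      (Asymptotics.isLittleO_pow_sub_sub t one_lt_two)
  rw [norm_pow, norm_norm]
  refine opNorm_le_of_basisVec _ (by positivity) fun i => ?_
  simp only [sub_apply, smul_apply, lift_basisVec]
  exact norm_sub_sub_smul_le_of_lipschitzWith_deriv (hd i) (hC i) s t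

lemma contDiff_one_lift (hv : ∀ t, ∃ C, ∀ i, ‖v t i‖ ≤ C) (hv' : ∀ t, ∃ C, ∀ i, ‖v' t i‖ ≤ C)
    (hd : ∀ i t, HasDerivAt (fun s => v s i) (v' t i) t)
    (hC : ∀ i, LipschitzWith C fun t => v' t i) :
    ContDiff ℝ 1 fun t => lift (𝕜 := ℝ) (v t) (hv t) := by
  have h := hasDerivAt_lift hv hv' hd hC
  refine contDiff_one_iff_deriv.2 ⟨fun t => (h t).differentiableAt, ?_⟩
  rw [funext fun t => (h t).deriv]
  exact (lipschitzWith_lift hv' hC).continuous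

end DifferentiableFamilies

section FourierSeries

/-- Real coefficient sequences. A sequence `p` encodes the pair `(ρ₁, ρ₂)` of an even and an odd
function through `ρ₁ + iρ₂ = ∑ₖ weight k * p k * exp (i k y)`. -/
abbrev Coeff := ℓ¹(ℤ, ℝ)

/-- The exponential weight that makes the encoded functions smooth. -/
def weight (k : ℤ) : ℝ := (1 / 2) ^ k.natAbs

lemma weight_pos (k : ℤ) : 0 < weight k := by
  unfold weight; positivity

lemma weight_neg (k : ℤ) : weight (-k) = weight k := by
  rw [weight, weight, Int.natAbs_neg]

lemma weight_mul_weight_le (i j : ℤ) : weight i * weight j ≤ weight (i + j) := by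
  rw [weight, weight, weight, ← pow_add]
  exact pow_le_pow_of_le_one (by norm_num) (by norm_num) (Int.natAbs_add_le i j)

lemma exists_weight_mul_abs_pow_le (n : ℕ) : ∃ C : ℝ≥0, ∀ k : ℤ, weight k * |(k : ℝ)| ^ n ≤ C := by
  obtain ⟨C, hC⟩ := (tendsto_pow_const_mul_const_pow_of_abs_lt_one n
    (show |(1 / 2 : ℝ)| < 1 by norm_num [abs_of_pos])).bddAbove_range
  have hC' : ∀ k : ℤ, weight k * |(k : ℝ)| ^ n ≤ C := fun k => by
    rw [← Int.cast_abs, Int.abs_eq_natAbs, Int.cast_natCast, mul_comm]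
    exact hC ⟨k.natAbs, rfl⟩
  exact ⟨⟨C, (mul_nonneg (weight_pos 0).le (by positivity)).trans (hC' 0)⟩, hC'⟩

/-- The `n`-th derivative of the weighted exponential `y ↦ weight k * exp (i k y)`. -/
def expMode (n : ℕ) (y : ℝ) (k : ℤ) : ℂ :=
  weight k * (k * Complex.I) ^ n * Complex.exp (k * Complex.I * y)

lemma norm_expMode (n : ℕ) (y : ℝ) (k : ℤ) : ‖expMode n y k‖ = weight k * |(k : ℝ)| ^ n := by
  have hexp : ‖Complex.exp (k * Complex.I * y)‖ = 1 := by
    rw [show (k * Complex.I * y : ℂ) = ((k * y : ℝ) : ℂ) * Complex.I by push_cast; ring,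
      Complex.norm_exp_ofReal_mul_I]
  rw [expMode, norm_mul, norm_mul, hexp, mul_one, norm_pow, norm_mul, Complex.norm_I, mul_one,
    Complex.norm_real, Real.norm_of_nonneg (weight_pos k).le, Complex.norm_intCast]

lemma exists_norm_expMode_le (n : ℕ) (y : ℝ) : ∃ C, ∀ k, ‖expMode n y k‖ ≤ C := by
  obtain ⟨C, hC⟩ := exists_weight_mul_abs_pow_le n
  exact ⟨C, fun k => (norm_expMode n y k).trans_le (hC k)⟩

lemma hasDerivAt_expMode (n : ℕ) (k : ℤ) (y : ℝ) :
    HasDerivAt (fun y => expMode n y k) (expMode (n + 1) y k) y := by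
  have := ((Complex.ofRealCLM.hasDerivAt (x := y)).const_mul (k * Complex.I : ℂ)).cexp.const_mul
    (weight k * (k * Complex.I) ^ n : ℂ)
  refine this.congr_deriv ?_
  simp only [expMode, Complex.ofRealCLM_apply, Complex.ofReal_one]
  ring

lemma exists_lipschitzWith_expMode (n : ℕ) :
    ∃ C : ℝ≥0, ∀ k, LipschitzWith C fun y => expMode n y k := by
  obtain ⟨C, hC⟩ := exists_weight_mul_abs_pow_le (n + 1)
  refine ⟨C, fun k => lipschitzWith_of_nnnorm_deriv_le
    (fun y => (hasDerivAt_expMode n k y).differentiableAt) fun y => ?_⟩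
  rw [(hasDerivAt_expMode n k y).deriv, ← NNReal.coe_le_coe, coe_nnnorm, norm_expMode]
  exact hC k

/-- The `n`-th derivative at `y` of the Fourier series with the given coefficients. -/
def fourierEval (n : ℕ) (y : ℝ) : Coeff →L[ℝ] ℂ :=
  lift (expMode n y) (exists_norm_expMode_le n y)

@[simp]
lemma fourierEval_basisVec (n : ℕ) (y : ℝ) (k : ℤ) :
    fourierEval n y (basisVec k) = expMode n y k :=
  lift_basisVec _ _ k

lemma exists_norm_fourierEval_le (n : ℕ) : ∃ C : ℝ≥0, ∀ y, ‖fourierEval n y‖ ≤ C := by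
  obtain ⟨C, hC⟩ := exists_weight_mul_abs_pow_le n
  refine ⟨C, fun y => opNorm_le_of_basisVec _ C.coe_nonneg fun k => ?_⟩
  rw [fourierEval_basisVec, norm_expMode]
  exact hC k

lemma hasDerivAt_fourierEval (n : ℕ) (y : ℝ) :
    HasDerivAt (fourierEval n) (fourierEval (n + 1) y) y := by
  obtain ⟨C, hC⟩ := exists_lipschitzWith_expMode (n + 1)
  exact hasDerivAt_lift (exists_norm_expMode_le n) (exists_norm_expMode_le (n + 1))
    (hasDerivAt_expMode n) hC y

lemma fourierEval_add_two_pi (n : ℕ) (y : ℝ) :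
    fourierEval n (y + 2 * Real.pi) = fourierEval n y := by
  refine clm_ext_basisVec fun k => ?_
  have : (k * Complex.I * ((y + 2 * Real.pi : ℝ) : ℂ)) =
      k * Complex.I * y + k * (2 * Real.pi * Complex.I) := by push_cast; ring
  rw [fourierEval_basisVec, fourierEval_basisVec, expMode, expMode, this,
    Complex.exp_periodic.int_mul k _]

lemma fourierEval_zero_neg (y : ℝ) (p : Coeff) :
    fourierEval 0 (-y) p = conj (fourierEval 0 y p) := by
  suffices fourierEval 0 (-y) = Complex.conjCLE.toContinuousLinearMap ∘L fourierEval 0 y from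
    DFunLike.congr_fun this p
  refine clm_ext_basisVec fun k => ?_
  simp [expMode, ← Complex.exp_conj]

variable {F : Type*} [NormedAddCommGroup F] [NormedSpace ℝ F] (T : ℂ →L[ℝ] F) (p : Coeff)

lemma hasDerivAt_clm_fourierEval (n : ℕ) (y : ℝ) :
    HasDerivAt (fun y => T (fourierEval n y p)) (T (fourierEval (n + 1) y p)) y :=
  T.hasFDerivAt.comp_hasDerivAt y
    ((ContinuousLinearMap.apply ℝ ℂ p).hasFDerivAt.comp_hasDerivAt y (hasDerivAt_fourierEval n y))

lemma iteratedDeriv_clm_fourierEval (m n : ℕ) :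
    iteratedDeriv m (fun y => T (fourierEval n y p)) = fun y => T (fourierEval (n + m) y p) := by
  induction m with
  | zero => rw [iteratedDeriv_zero, add_zero]
  | succ m ih =>
    rw [iteratedDeriv_succ, ih]
    exact funext fun y => (hasDerivAt_clm_fourierEval T p (n + m) y).deriv

lemma contDiff_clm_fourierEval (n : ℕ) :
    ContDiff ℝ ((⊤ : ℕ∞) : WithTop ℕ∞) fun y => T (fourierEval n y p) := by
  refine contDiff_of_differentiable_iteratedDeriv fun m _ y => ?_
  rw [iteratedDeriv_clm_fourierEval]
  exact (hasDerivAt_clm_fourierEval T p (n + m) y).differentiableAt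

lemma isSmoothPeriodic_clm_fourierEval (T : ℂ →L[ℝ] ℝ) :
    IsSmoothPeriodic fun y => T (fourierEval 0 y p) :=
  ⟨contDiff_clm_fourierEval T p 0, fun y => by simp only [fourierEval_add_two_pi]⟩

lemma exists_sobolevInftyNorm_clm_fourierEval_le (T : ℂ →L[ℝ] ℝ) (r : ℕ) :
    ∃ C : ℝ≥0, ∀ p, sobolevInftyNorm r (fun y => T (fourierEval 0 y p)) ≤
      ENNReal.ofReal (C * ‖p‖) := by
  choose C hC using exists_norm_fourierEval_le
  refine ⟨∑ k ∈ Finset.range (r + 1), ‖T‖₊ * C k, fun p => ?_⟩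
  rw [NNReal.coe_sum, Finset.sum_mul, ENNReal.ofReal_sum_of_nonneg fun k _ => by positivity]
  refine Finset.sum_le_sum fun k _ => MeasureTheory.eLpNormEssSup_le_of_ae_bound ?_
  refine Filter.Eventually.of_forall fun y => ?_
  rw [iteratedDeriv_clm_fourierEval, zero_add, NNReal.coe_mul, coe_nnnorm, mul_assoc]
  exact T.le_opNorm_of_le ((fourierEval k y).le_of_opNorm_le (hC k y) p)

end FourierSeries

section EncodedOperations

/-- The product of `ℓ¹(ℤ)` that encodes the pointwise product of Fourier series. -/
def wienerMul : Coeff →L[ℝ] Coeff →L[ℝ] Coeff :=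
  have hle (i j : ℤ) :
      ‖(weight i * weight j / weight (i + j)) • (basisVec (i + j) : Coeff)‖ ≤ 1 := by
    have hi := weight_pos i
    have hj := weight_pos j
    have hij := weight_pos (i + j)
    rw [norm_smul, norm_basisVec, mul_one, Real.norm_of_nonneg (by positivity), div_le_one hij]
    exact weight_mul_weight_le i j
  lift (fun i => lift (fun j => (weight i * weight j / weight (i + j)) • basisVec (i + j))
      ⟨1, hle i⟩)
    ⟨1, fun i => opNorm_le_of_basisVec _ zero_le_one fun j => by
      rw [lift_basisVec]
      exact hle i j⟩

lemma wienerMul_basisVec (i j : ℤ) : wienerMul (basisVec i) (basisVec j) =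
    (weight i * weight j / weight (i + j)) • basisVec (i + j) := by
  rw [wienerMul, lift_basisVec, lift_basisVec]

lemma expMode_zero_add (y : ℝ) (i j : ℤ) : (weight i * weight j / weight (i + j)) •
    expMode 0 y (i + j) = expMode 0 y i * expMode 0 y j := by
  have hw : (weight (i + j) : ℂ) ≠ 0 := Complex.ofReal_ne_zero.2 (weight_pos _).ne'
  simp only [expMode, pow_zero, mul_one, Complex.real_smul, Int.cast_add, add_mul, Complex.exp_add]
  push_cast
  field_simp

lemma fourierEval_wienerMul (y : ℝ) (p q : Coeff) :
    fourierEval 0 y (wienerMul p q) = fourierEval 0 y p * fourierEval 0 y q := by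
  suffices ContinuousLinearMap.compL ℝ Coeff Coeff ℂ (fourierEval 0 y) ∘L wienerMul =
      (ContinuousLinearMap.mul ℝ ℂ).bilinearComp (fourierEval 0 y) (fourierEval 0 y) from
    DFunLike.congr_fun (DFunLike.congr_fun this p) q
  refine clm_ext_basisVec fun i => clm_ext_basisVec fun j => ?_
  simp only [ContinuousLinearMap.comp_apply, ContinuousLinearMap.compL_apply, wienerMul_basisVec,
    map_smul, fourierEval_basisVec, expMode_zero_add, ContinuousLinearMap.bilinearComp_apply,
    ContinuousLinearMap.mul_apply']

/-- The reflection `k ↦ -k` of coefficient sequences, which encodes complex conjugation. -/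
def reflect : Coeff →L[ℝ] Coeff :=
  lift (fun k => basisVec (-k)) ⟨1, fun k => (norm_basisVec (-k)).le⟩

lemma reflect_basisVec (k : ℤ) : reflect (basisVec k) = basisVec (-k) := lift_basisVec _ _ k

lemma reflect_apply (p : Coeff) (k : ℤ) : reflect p k = p (-k) := by
  suffices coord k ∘L reflect = coord (-k) from DFunLike.congr_fun this p
  refine clm_ext_basisVec fun j => ?_
  simp [reflect_basisVec, basisVec_apply, neg_eq_iff_eq_neg]

lemma fourierEval_reflect (y : ℝ) (p : Coeff) :
    fourierEval 0 y (reflect p) = conj (fourierEval 0 y p) := by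
  suffices fourierEval 0 y ∘L reflect =
      Complex.conjCLE.toContinuousLinearMap ∘L fourierEval 0 y from DFunLike.congr_fun this p
  refine clm_ext_basisVec fun k => ?_
  simp [reflect_basisVec, expMode, weight_neg, ← Complex.exp_conj]

/-- The encoding of the quadratic map `Q(ρ, ρ)`, which in terms of `f = ρ₁ + iρ₂` reads
`|f|² + (f² - conj f ²) / 2`. -/
def quad (u : Coeff) : Coeff :=
  wienerMul u (reflect u) +
    (1 / 2 : ℝ) • (wienerMul u u - wienerMul (reflect u) (reflect u))

lemma fourierEval_quad (y : ℝ) (p : Coeff) : fourierEval 0 y (quad p) =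
    fourierEval 0 y p * conj (fourierEval 0 y p) +
      (1 / 2 : ℝ) • (fourierEval 0 y p * fourierEval 0 y p -
        conj (fourierEval 0 y p) * conj (fourierEval 0 y p)) := by
  simp only [quad, map_add, map_sub, map_smul, fourierEval_wienerMul, fourierEval_reflect]

lemma quad_smul (a : ℝ) (u : Coeff) : quad (a • u) = a ^ 2 • quad u := by
  simp only [quad, map_smul, smul_apply]
  module

/-- The Fourier multiplier with a bounded real symbol. -/
def multiplier (m : ℤ → ℝ) (hm : ∃ C, ∀ k, ‖m k‖ ≤ C) : Coeff →L[ℝ] Coeff :=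
  lift (fun k => m k • basisVec k) (by simpa only [norm_smul, norm_basisVec, mul_one] using hm)

lemma multiplier_basisVec (m : ℤ → ℝ) (hm : ∃ C, ∀ k, ‖m k‖ ≤ C) (k : ℤ) :
    multiplier m hm (basisVec k) = m k • basisVec k :=
  lift_basisVec _ _ k

lemma multiplier_apply (m : ℤ → ℝ) (hm : ∃ C, ∀ k, ‖m k‖ ≤ C) (p : Coeff) (k : ℤ) :
    multiplier m hm p k = m k * p k := by
  suffices coord k ∘L multiplier m hm = m k • coord k from DFunLike.congr_fun this p
  refine clm_ext_basisVec fun j => ?_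
  by_cases h : k = j <;> simp [multiplier_basisVec, basisVec_apply, h]

/-- The mean `f ↦ (f(· + ω) + f(· - ω)) / 2` on Fourier coefficients. -/
def cosMultiplier (ω : ℝ) : Coeff →L[ℝ] Coeff :=
  multiplier (fun k => Real.cos (k * ω)) ⟨1, fun _ => Real.abs_cos_le_one _⟩

/-- The difference `f ↦ (f(· + ω) - f(· - ω)) / (2 * i)` on Fourier coefficients. -/
def sinMultiplier (ω : ℝ) : Coeff →L[ℝ] Coeff :=
  multiplier (fun k => Real.sin (k * ω)) ⟨1, fun _ => Real.abs_sin_le_one _⟩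

lemma cosMultiplier_neg (ω : ℝ) : cosMultiplier (-ω) = cosMultiplier ω := by
  simp only [cosMultiplier, mul_neg, Real.cos_neg]

lemma sinMultiplier_neg (ω : ℝ) : sinMultiplier (-ω) = -sinMultiplier ω :=
  clm_ext_basisVec fun k => by
    simp only [sinMultiplier, neg_apply, multiplier_basisVec, mul_neg, Real.sin_neg, neg_smul]

lemma cosMultiplier_reflect (ω : ℝ) (p : Coeff) :
    cosMultiplier ω (reflect p) = reflect (cosMultiplier ω p) :=
  lp.ext <| funext fun k => by
    simp only [cosMultiplier, multiplier_apply, reflect_apply, Int.cast_neg, neg_mul, Real.cos_neg]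

lemma expMode_zero_add_right (y ω : ℝ) (k : ℤ) : expMode 0 (y + ω) k =
    (Real.cos (k * ω) + Real.sin (k * ω) * Complex.I) * expMode 0 y k := by
  have : (k * Complex.I * ((y + ω : ℝ) : ℂ)) =
      ((k * ω : ℝ) : ℂ) * Complex.I + k * Complex.I * y := by
    push_cast; ring
  rw [expMode, expMode, this, Complex.exp_add, Complex.exp_mul_I, Complex.ofReal_cos,
    Complex.ofReal_sin]
  ring

lemma fourierEval_add (y ω : ℝ) (p : Coeff) : fourierEval 0 (y + ω) p =
    fourierEval 0 y (cosMultiplier ω p) + Complex.I * fourierEval 0 y (sinMultiplier ω p) := by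
  suffices fourierEval 0 (y + ω) = fourierEval 0 y ∘L cosMultiplier ω +
      Complex.I • fourierEval 0 y ∘L sinMultiplier ω from DFunLike.congr_fun this p
  refine clm_ext_basisVec fun k => ?_
  simp only [fourierEval_basisVec, add_apply, smul_apply, ContinuousLinearMap.comp_apply,
    cosMultiplier, sinMultiplier, multiplier_basisVec, map_smul, expMode_zero_add_right,
    Complex.real_smul, smul_eq_mul]
  ring

lemma fourierEval_sub (y ω : ℝ) (p : Coeff) : fourierEval 0 (y - ω) p =
    fourierEval 0 y (cosMultiplier ω p) - Complex.I * fourierEval 0 y (sinMultiplier ω p) := by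
  rw [sub_eq_add_neg, fourierEval_add, cosMultiplier_neg, sinMultiplier_neg, neg_apply, map_neg,
    mul_neg, ← sub_eq_add_neg]

/-- The operator `D_μ` on Fourier coefficients, for shifts of length `ω`. -/
def latticeOp (μ ω : ℝ) : Coeff →L[ℝ] Coeff :=
  (2 + μ) • (.id ℝ Coeff - cosMultiplier ω ∘L reflect) + μ • sinMultiplier ω

lemma latticeOp_apply (μ ω : ℝ) (p : Coeff) (k : ℤ) : latticeOp μ ω p k =
    (2 + μ) * (p k - Real.cos (k * ω) * p (-k)) + μ * (Real.sin (k * ω) * p k) := by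
  rw [← reflect_apply, ← multiplier_apply _ ⟨1, fun k => Real.abs_cos_le_one (k * ω)⟩,
    ← multiplier_apply _ ⟨1, fun k => Real.abs_sin_le_one (k * ω)⟩]
  rfl

lemma fourierEval_latticeOp (μ ω y : ℝ) (p : Coeff) : fourierEval 0 y (latticeOp μ ω p) =
    (2 + μ) * (fourierEval 0 y p - conj (fourierEval 0 y (cosMultiplier ω p))) +
      μ * fourierEval 0 y (sinMultiplier ω p) := by
  simp [latticeOp, cosMultiplier_reflect, fourierEval_reflect]

lemma fourierEval_eq_neg_smul {s : ℝ} {u v : Coeff} (h : ∀ k : ℤ, s * k ^ 2 * u k = v k) (y : ℝ) :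
    fourierEval 0 y v = -(s • fourierEval 2 y u) := by
  have hu := (((hasSum_smul_basisVec u).mapL (fourierEval 2 y)).const_smul s).neg
  have hv := (hasSum_smul_basisVec v).mapL (fourierEval 0 y)
  refine hv.unique (hu.congr_fun fun k => ?_)
  simp only [map_smul, fourierEval_basisVec, ← h, expMode, mul_pow, Complex.I_sq,
    Complex.real_smul]
  push_cast
  ring

end EncodedOperations

section EncodedProfiles

/-- The real part of the encoded function, which is its even component. -/
def evenPart : Coeff →ₗ[ℝ] ℝ → ℝ := LinearMap.pi fun y => Complex.reCLM ∘L fourierEval 0 y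

/-- The imaginary part of the encoded function, which is its odd component. -/
def oddPart : Coeff →ₗ[ℝ] ℝ → ℝ := LinearMap.pi fun y => Complex.imCLM ∘L fourierEval 0 y

lemma evenPart_apply (p : Coeff) (y : ℝ) : evenPart p y = (fourierEval 0 y p).re := rfl

lemma oddPart_apply (p : Coeff) (y : ℝ) : oddPart p y = (fourierEval 0 y p).im := rfl

lemma even_evenPart (p : Coeff) : Function.Even (evenPart p) := fun y => by
  rw [evenPart_apply, fourierEval_zero_neg, Complex.conj_re, evenPart_apply]

lemma odd_oddPart (p : Coeff) : Function.Odd (oddPart p) := fun y => by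
  rw [oddPart_apply, fourierEval_zero_neg, Complex.conj_im, oddPart_apply]

/-- The pair of real functions encoded by a coefficient sequence, rescaled to frequency `ω`. -/
def toProfile (ω : ℝ) : Coeff →ₗ[ℝ] Profile where
  toFun p := (fun x => evenPart p (ω * x), fun x => oddPart p (ω * x))
  map_add' p q := by ext x <;> simp only [map_add, Pi.add_apply, Prod.mk_add_mk]
  map_smul' a p := by ext x <;> simp only [map_smul, Pi.smul_apply, Prod.smul_mk, RingHom.id_apply]

lemma toProfile_apply (ω : ℝ) (p : Coeff) : toProfile ω p =
    (fun x => (fourierEval 0 (ω * x) p).re, fun x => (fourierEval 0 (ω * x) p).im) := rfl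

lemma isSmoothPeriodic_evenPart (p : Coeff) : IsSmoothPeriodic (evenPart p) :=
  isSmoothPeriodic_clm_fourierEval p Complex.reCLM

lemma isSmoothPeriodic_oddPart (p : Coeff) : IsSmoothPeriodic (oddPart p) :=
  isSmoothPeriodic_clm_fourierEval p Complex.imCLM

lemma nonlin_toProfile (ω : ℝ) (p : Coeff) :
    nonlin (toProfile ω p) (toProfile ω p) = toProfile ω (quad p) := by
  ext x
  all_goals
    simp only [nonlin, toProfile_apply, fourierEval_quad, Pi.add_apply, Pi.mul_apply,
      Complex.add_re, Complex.add_im, Complex.sub_re, Complex.sub_im, Complex.smul_re,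
      Complex.smul_im, Complex.mul_re, Complex.mul_im, Complex.conj_re, Complex.conj_im,
      smul_eq_mul]
    ring

lemma opD_toProfile (μ ω : ℝ) (p : Coeff) :
    opD μ (toProfile ω p) = toProfile ω (latticeOp μ ω p) := by
  have hsub (x : ℝ) : ω * (x + -1) = ω * x - ω := by ring
  have hreal : (2 + μ : ℂ) = (2 + μ : ℝ) := by push_cast; rfl
  ext x
  all_goals
    simp only [opD, opA, opDelta, shift, toProfile_apply, mul_add_one, hsub, fourierEval_add,
      fourierEval_sub, fourierEval_latticeOp, hreal, Pi.add_apply, Pi.sub_apply, Pi.neg_apply,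
      Pi.smul_apply, smul_eq_mul, Complex.add_re, Complex.add_im, Complex.sub_re, Complex.sub_im,
      Complex.re_ofReal_mul, Complex.im_ofReal_mul, Complex.I_mul_re, Complex.I_mul_im,
      Complex.conj_re, Complex.conj_im]
    ring

lemma secondDeriv_toProfile {c ω : ℝ} {u v : Coeff}
    (h : ∀ k : ℤ, c ^ 2 * ω ^ 2 * k ^ 2 * u k = v k) :
    c ^ 2 • secondDeriv (toProfile ω u) = -toProfile ω v := by
  have hT (T : ℂ →L[ℝ] ℝ) (x : ℝ) :
      c ^ 2 * iteratedDeriv 2 (fun x => T (fourierEval 0 (ω * x) u)) x =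
        -T (fourierEval 0 (ω * x) v) := by
    rw [iteratedDeriv_comp_const_mul (contDiff_infty.1 (contDiff_clm_fourierEval T u 0) 2),
      iteratedDeriv_clm_fourierEval, fourierEval_eq_neg_smul h]
    simp only [map_neg, map_smul, neg_neg, zero_add, smul_eq_mul, mul_assoc]
  exact Prod.ext (funext (hT Complex.reCLM)) (funext (hT Complex.imCLM))

/-- The traveling wave equation for `a • toProfile ω u`, divided by `a`, in terms of Fourier
coefficients. -/
def IsFourierSolution (c μ a ω : ℝ) (u : Coeff) : Prop :=
  ∀ k : ℤ, c ^ 2 * ω ^ 2 * k ^ 2 * u k = latticeOp μ ω (u + a • quad u) k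

lemma IsFourierSolution.travelingWaveOp_eq_zero {c μ a ω : ℝ} {u : Coeff}
    (h : IsFourierSolution c μ a ω u) : travelingWaveOp c (a • toProfile ω u) μ = 0 := by
  have hk (k : ℤ) : c ^ 2 * ω ^ 2 * k ^ 2 * (a • u) k =
      (a • latticeOp μ ω (u + a • quad u)) k := by
    rw [lp.coeFn_smul, lp.coeFn_smul, Pi.smul_apply, Pi.smul_apply, ← h k, smul_eq_mul, smul_eq_mul]
    ring
  have hlin : a • latticeOp μ ω (u + a • quad u) =
      latticeOp μ ω (a • u) + latticeOp μ ω (a ^ 2 • quad u) := by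
    rw [sq, mul_smul, map_smul, map_smul, ← smul_add, ← map_add]
  rw [travelingWaveOp, ← map_smul, secondDeriv_toProfile hk, nonlin_toProfile, opD_toProfile,
    opD_toProfile, quad_smul, hlin, map_add, add_assoc, neg_add_cancel]

end EncodedProfiles

section ImplicitFunctions

variable {𝕜 : Type*}

lemma exists_lipschitz_implicit {E₁ E₂ F : Type*} [RCLike 𝕜] [NormedAddCommGroup E₁]
    [NormedSpace 𝕜 E₁] [CompleteSpace E₁] [NormedAddCommGroup E₂] [NormedSpace 𝕜 E₂]
    [CompleteSpace E₂] [NormedAddCommGroup F] [NormedSpace 𝕜 F] [CompleteSpace F] {f : E₁ × E₂ → F}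
    {x₀ : E₁} {y₀ : E₂} {T : E₂ →L[𝕜] F} (hf : ContDiffAt 𝕜 1 f (x₀, y₀))
    (hT : HasFDerivAt (fun y => f (x₀, y)) T y₀) (hinv : T.IsInvertible) :
    ∃ ψ : E₁ → E₂, (∃ K, ∃ s ∈ nhds x₀, LipschitzOnWith K ψ s) ∧
      Filter.Tendsto ψ (nhds x₀) (nhds y₀) ∧ ∀ᶠ x in nhds x₀, f (x, ψ x) = f (x₀, y₀) := by
  have hs := hf.hasStrictFDerivAt one_ne_zero
  obtain rfl : fderiv 𝕜 f (x₀, y₀) ∘L .inr 𝕜 E₁ E₂ = T :=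
    (hs.hasFDerivAt.comp y₀ (hasFDerivAt_prodMk_right x₀ y₀)).unique hT
  exact ⟨hs.implicitFunctionOfProdDomain hinv,
    (hs.hasStrictFDerivAt_implicitFunctionOfProdDomain hinv).exists_lipschitzOnWith,
    hs.tendsto_implicitFunctionOfProdDomain hinv,
    hs.eventually_apply_implicitFunctionOfProdDomain hinv⟩

variable {E : Type*} [NontriviallyNormedField 𝕜] [NormedAddCommGroup E] [NormedSpace 𝕜 E]
  {S : E →L[𝕜] 𝕜} {v : E}

/-- The bordered operator `(t, w) ↦ (S w, A w + t v)`, the linearization of an eigenvalue problem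
normalized by `S` at an eigenvector `v`. -/
def bordered (S : E →L[𝕜] 𝕜) (A : E →L[𝕜] E) (v : E) : 𝕜 × E →L[𝕜] 𝕜 × E :=
  (S ∘L .snd 𝕜 𝕜 E).prod
    (A ∘L .snd 𝕜 𝕜 E + (ContinuousLinearMap.fst 𝕜 𝕜 E).smulRight v)

lemma isInvertible_bordered {A : E →L[𝕜] E} {β : 𝕜} (hA : A v = 0) (hS : S v = 1) (hβ : β ≠ 0)
    (hM : IsUnit (A + S.smulRight v)) : (bordered S A (β • v)).IsInvertible := by
  obtain ⟨⟨M, N, hMN, hNM⟩, rfl : M = A + S.smulRight v⟩ := hM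
  have hAN (h : E) : A (N h) = h - S (N h) • v := eq_sub_of_add_eq (DFunLike.congr_fun hMN h)
  have hNA (w : E) : N (A w) = w - S w • N v := by
    rw [eq_sub_iff_add_eq, ← map_smul, ← map_add]
    exact DFunLike.congr_fun hNM w
  have hNv : N v = v := by
    have h := hNA v
    rw [hA, hS, map_zero, one_smul, eq_comm, sub_eq_zero] at h
    exact h.symm
  refine .of_inverse (g := (β⁻¹ • S ∘L N ∘L .snd 𝕜 𝕜 E).prod (N ∘L .snd 𝕜 𝕜 E -
    (S ∘L N ∘L .snd 𝕜 𝕜 E - .fst 𝕜 𝕜 E).smulRight v)) ?_ ?_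
  · ext <;> simp [bordered, hA, hS, hAN, smul_smul, mul_right_comm β⁻¹, hβ]
  · ext <;> simp [bordered, hNA, hNv, hS, hβ]

variable {B : 𝕜 → E →L[𝕜] E} {g : 𝕜 → 𝕜} {g' t₀ : 𝕜}

lemma hasFDerivAt_normalized_eigenproblem (hB : DifferentiableAt 𝕜 B t₀)
    (hv : ∀ t, B t v = g t • v) (hg : HasDerivAt g g' t₀) :
    HasFDerivAt (fun z : 𝕜 × E => (S z.2 - 1, z.2 - B z.1 z.2))
      (bordered S (1 - B t₀) (-g' • v)) (t₀, v) := by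
  have hBv : deriv B t₀ v = g' • v := by
    have hd := hB.hasDerivAt.clm_apply (hasDerivAt_const t₀ v)
    simp only [hv, map_zero, add_zero] at hd
    exact hd.unique (hg.smul_const v)
  have hfst : HasFDerivAt (fun z : 𝕜 × E => B z.1) _ (t₀, v) :=
    hB.hasFDerivAt.comp (t₀, v) hasFDerivAt_fst
  refine (((S.hasFDerivAt.comp (t₀, v) hasFDerivAt_snd).sub_const 1).prodMk
    (hasFDerivAt_snd.fun_sub (hfst.clm_apply hasFDerivAt_snd))).congr_fderiv ?_
  ext <;> simp [bordered, hBv]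

end ImplicitFunctions

section WaveOperator

lemma norm_inv_intCast_pow_le_one (k : ℤ) (n : ℕ) : ‖((k : ℝ) ^ n)⁻¹‖ ≤ 1 := by
  obtain rfl | hk := eq_or_ne k 0
  · rcases n with - | n <;> simp
  · rw [norm_inv, norm_pow, Real.norm_eq_abs]
    exact inv_le_one_of_one_le₀ (one_le_pow₀ (by exact_mod_cast Int.one_le_abs hk))

/-- The Fourier multiplier `k⁻²`. Since `0⁻¹ = 0`, it annihilates the mean. -/
def invLaplacian : Coeff →L[ℝ] Coeff :=
  multiplier (fun k => ((k : ℝ) ^ 2)⁻¹) ⟨1, fun k => norm_inv_intCast_pow_le_one k 2⟩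

lemma contDiff_one_invLaplacian_comp_multiplier {g g' : ℝ → ℝ} (hg : ∀ t, HasDerivAt g (g' t) t)
    (hb : ∀ t, ‖g t‖ ≤ 1) (hb' : ∀ t, ‖g' t‖ ≤ 1) (hlip : LipschitzWith 1 g') :
    ContDiff ℝ 1 fun ω => invLaplacian ∘L
      multiplier (fun k : ℤ => g (k * ω)) ⟨1, fun _ => hb _⟩ := by
  have hv (ω : ℝ) (k : ℤ) : ‖(((k : ℝ) ^ 2)⁻¹ * g (k * ω)) • (basisVec k : Coeff)‖ ≤ 1 := by
    rw [norm_smul, norm_basisVec, mul_one, norm_mul]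
    exact mul_le_one₀ (norm_inv_intCast_pow_le_one k 2) (norm_nonneg _) (hb _)
  have hv' (ω : ℝ) (k : ℤ) : ‖((k : ℝ)⁻¹ * g' (k * ω)) • (basisVec k : Coeff)‖ ≤ 1 := by
    rw [norm_smul, norm_basisVec, mul_one, norm_mul]
    exact mul_le_one₀ (by simpa using norm_inv_intCast_pow_le_one k 1) (norm_nonneg _) (hb' _)
  have hd (k : ℤ) (ω : ℝ) : HasDerivAt
      (fun ω => (((k : ℝ) ^ 2)⁻¹ * g (k * ω)) • (basisVec k : Coeff))
      (((k : ℝ)⁻¹ * g' (k * ω)) • basisVec k) ω := by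
    refine ((((hg (k * ω)).comp ω (hasDerivAt_const_mul (k : ℝ))).const_mul
      ((k : ℝ) ^ 2)⁻¹).smul_const (basisVec k : Coeff)).congr_deriv ?_
    congr 1
    obtain hk | hk := eq_or_ne (k : ℝ) 0
    · simp [hk]
    · field_simp
  have hlip' (k : ℤ) : LipschitzWith 1
      fun ω => ((k : ℝ)⁻¹ * g' (k * ω)) • (basisVec k : Coeff) :=
    LipschitzWith.of_dist_le_mul fun ω ω' => by
      rw [dist_eq_norm, ← sub_smul, norm_smul, norm_basisVec, mul_one, ← mul_sub, norm_mul,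
        NNReal.coe_one, one_mul, norm_inv]
      refine inv_mul_le_of_le_mul₀ (norm_nonneg _) dist_nonneg ?_
      rw [← dist_eq_norm]
      simpa [Real.dist_eq, ← mul_sub, abs_mul] using hlip.dist_le_mul (k * ω) (k * ω')
  convert contDiff_one_lift (fun ω => ⟨1, hv ω⟩) (fun ω => ⟨1, hv' ω⟩) hd hlip' using 2 with ω
  refine clm_ext_basisVec fun k => ?_
  rw [ContinuousLinearMap.comp_apply, multiplier_basisVec, map_smul, invLaplacian,
    multiplier_basisVec, lift_basisVec, smul_smul, mul_comm]

/-- The operator `-c⁻² ∂⁻² D_μ` for profiles of frequency `ω`. -/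
def waveOp (c μ ω : ℝ) : Coeff →L[ℝ] Coeff :=
  (c ^ 2 * ω ^ 2)⁻¹ • invLaplacian ∘L latticeOp μ ω

lemma waveOp_apply (c μ ω : ℝ) (p : Coeff) (k : ℤ) :
    waveOp c μ ω p k = (c ^ 2 * ω ^ 2)⁻¹ * (((k : ℝ) ^ 2)⁻¹ * latticeOp μ ω p k) :=
  congrArg ((c ^ 2 * ω ^ 2)⁻¹ * ·)
    (multiplier_apply _ ⟨1, fun k => norm_inv_intCast_pow_le_one k 2⟩ _ k)

lemma contDiffAt_waveOp {c μ ω : ℝ} (h : c ^ 2 * ω ^ 2 ≠ 0) :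
    ContDiffAt ℝ 1 (fun x : ℝ × ℝ => waveOp c x.1 x.2) (μ, ω) := by
  have hcos : ContDiff ℝ 1 fun ω => invLaplacian ∘L cosMultiplier ω :=
    contDiff_one_invLaplacian_comp_multiplier Real.hasDerivAt_cos Real.abs_cos_le_one
      (fun t => by simpa using Real.abs_sin_le_one t) Real.lipschitzWith_sin.neg
  have hsin : ContDiff ℝ 1 fun ω => invLaplacian ∘L sinMultiplier ω :=
    contDiff_one_invLaplacian_comp_multiplier Real.hasDerivAt_sin Real.abs_sin_le_one
      Real.abs_cos_le_one Real.lipschitzWith_cos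
  have heq : (fun x : ℝ × ℝ => waveOp c x.1 x.2) = fun x => (c ^ 2 * x.2 ^ 2)⁻¹ •
      ((2 + x.1) • (invLaplacian - (invLaplacian ∘L cosMultiplier x.2) ∘L reflect) +
        x.1 • (invLaplacian ∘L sinMultiplier x.2)) := by
    ext x p k
    simp [waveOp, latticeOp]
  rw [heq]
  have hcos' : ContDiff ℝ 1 fun x : ℝ × ℝ => invLaplacian ∘L cosMultiplier x.2 :=
    hcos.comp contDiff_snd
  have hsin' : ContDiff ℝ 1 fun x : ℝ × ℝ => invLaplacian ∘L sinMultiplier x.2 :=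
    hsin.comp contDiff_snd
  have hinv : ContDiffAt ℝ 1 (fun x : ℝ × ℝ => (c ^ 2 * x.2 ^ 2)⁻¹) (μ, ω) :=
    ContDiffAt.inv (by fun_prop) h
  exact hinv.smul (by fun_prop)

lemma latticeOp_apply_zero (μ ω : ℝ) (p : Coeff) : latticeOp μ ω p 0 = 0 := by
  simp [latticeOp_apply]

lemma isFourierSolution_of_eq_waveOp {c μ a ω : ℝ} {u : Coeff} (hω : c ^ 2 * ω ^ 2 ≠ 0)
    (h : u = waveOp c μ ω (u + a • quad u)) : IsFourierSolution c μ a ω u := by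
  intro k
  obtain rfl | hk := eq_or_ne k 0
  · rw [latticeOp_apply_zero, Int.cast_zero, zero_pow two_ne_zero, mul_zero, zero_mul]
  · have hk' : (k : ℝ) ^ 2 ≠ 0 := pow_ne_zero 2 (Int.cast_ne_zero.2 hk)
    conv_lhs => rw [h, waveOp_apply, mul_assoc, mul_left_comm _ (c ^ 2 * ω ^ 2)⁻¹,
      mul_inv_cancel_left₀ hk', mul_inv_cancel_left₀ hω]

lemma apply_zero_of_eq_waveOp {c μ ω : ℝ} {u v : Coeff} (h : u = waveOp c μ ω v) : u 0 = 0 := by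
  rw [h, waveOp_apply, latticeOp_apply_zero, mul_zero, mul_zero]

end WaveOperator

section Bifurcation

/-- The sine coefficient of the odd component. -/
def sinCoeff : Coeff →L[ℝ] ℝ := (1 / 2 : ℝ) • (coord 1 - coord (-1))

/-- The Fourier coefficients of the profile `(υ cos, sin)`. -/
def profileVec (υ : ℝ) : Coeff := (υ + 1) • basisVec 1 + (υ - 1) • basisVec (-1)

lemma toProfile_profileVec_add (υ ω : ℝ) (w : Coeff) :
    toProfile ω (profileVec υ + w) = periodicProfile υ ω (evenPart w) (oddPart w) := by
  have h (y : ℝ) : fourierEval 0 y (profileVec υ) =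
      (υ * Real.cos y : ℝ) + (Real.sin y : ℝ) * Complex.I := by
    have hw : weight 1 = 1 / 2 := by norm_num [weight]
    have hy : Complex.exp (-1 * Complex.I * y) = Real.cos y - Real.sin y * Complex.I := by
      rw [show -1 * Complex.I * y = ((-y : ℝ) : ℂ) * Complex.I by push_cast; ring,
        Complex.exp_mul_I, ← Complex.ofReal_cos, ← Complex.ofReal_sin, Real.cos_neg, Real.sin_neg]
      push_cast
      ring
    have hy' : Complex.exp (1 * Complex.I * y) = Real.cos y + Real.sin y * Complex.I := by
      rw [one_mul, mul_comm, Complex.exp_mul_I, ← Complex.ofReal_cos, ← Complex.ofReal_sin]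
    simp only [profileVec, map_add, map_smul, fourierEval_basisVec, expMode, Int.cast_one, hy,
      Int.cast_neg, hy', weight_neg, hw, Complex.real_smul, pow_zero, mul_one]
    push_cast
    ring
  ext x <;> simp only [toProfile_apply, periodicProfile, evenPart_apply, oddPart_apply, map_add,
    h] <;> simp [-Complex.ofReal_cos, -Complex.ofReal_sin]

lemma profileVec_apply (υ : ℝ) (k : ℤ) : profileVec υ k =
    (υ + 1) * (if k = 1 then 1 else 0) + (υ - 1) * (if k = -1 then 1 else 0) := by
  rw [← coord_apply k (profileVec υ)]
  simp only [profileVec, map_add, map_smul, coord_apply, basisVec_apply, smul_eq_mul]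

lemma sinCoeff_apply (u : Coeff) : sinCoeff u = (u 1 - u (-1)) / 2 := by
  rw [div_eq_inv_mul, ← one_div]
  rfl

lemma sinCoeff_profileVec (υ : ℝ) : sinCoeff (profileVec υ) = 1 := by
  norm_num [sinCoeff_apply, profileVec_apply]

lemma latticeOp_basisVec (μ ω : ℝ) (k : ℤ) : latticeOp μ ω (basisVec k) =
    (2 + μ) • (basisVec k - Real.cos (k * ω) • basisVec (-k)) +
      (μ * Real.sin (k * ω)) • basisVec k := by
  simp [latticeOp, reflect_basisVec, cosMultiplier, sinMultiplier, multiplier_basisVec, mul_smul]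

lemma waveOp_basisVec (c μ ω : ℝ) (k : ℤ) : waveOp c μ ω (basisVec k) =
    ((c ^ 2 * ω ^ 2)⁻¹ * ((k : ℝ) ^ 2)⁻¹) • latticeOp μ ω (basisVec k) := by
  simp only [waveOp, invLaplacian, latticeOp_basisVec, smul_apply, ContinuousLinearMap.comp_apply,
    map_add, map_sub, map_smul, multiplier_basisVec, Int.cast_neg, neg_sq]
  module

lemma waveOp_profileVec_zero (c ω : ℝ) : waveOp c 0 ω (profileVec 0) =
    ((2 + 2 * Real.cos ω) / (c ^ 2 * ω ^ 2)) • profileVec 0 := by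
  simp only [profileVec, map_add, map_smul, waveOp_basisVec, latticeOp_basisVec]
  norm_num
  module

/-- The equation `u = -c⁻² ∂⁻² D_μ (u + a Q(u))` together with the normalization of the sine
coefficient, for parameters `(μ, a)` and unknowns `(ω, u)`. -/
def bifurcationMap (c : ℝ) (z : (ℝ × ℝ) × ℝ × Coeff) : ℝ × Coeff :=
  (sinCoeff z.2.2 - 1, z.2.2 - waveOp c z.1.1 z.2.1 (z.2.2 + z.1.2 • quad z.2.2))

lemma contDiffAt_bifurcationMap {c ω : ℝ} (h : c ^ 2 * ω ^ 2 ≠ 0) (μ a : ℝ) (u : Coeff) :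
    ContDiffAt ℝ 1 (bifurcationMap c) ((μ, a), ω, u) := by
  have hK : ContDiffAt ℝ 1 (fun z : (ℝ × ℝ) × ℝ × Coeff => waveOp c z.1.1 z.2.1) ((μ, a), ω, u) :=
    (contDiffAt_waveOp h).comp ((μ, a), ω, u)
      (f := fun z : (ℝ × ℝ) × ℝ × Coeff => (z.1.1, z.2.1)) (by fun_prop)
  unfold bifurcationMap quad
  fun_prop

lemma norm_waveOp_sub_smulRight_basisVec_of_abs_eq_one {c ω : ℝ} (hcos : 0 < Real.cos ω)
    (h : c ^ 2 * ω ^ 2 = 2 + 2 * Real.cos ω) {k : ℤ} (hk : |k| = 1) :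
    ‖(waveOp c 0 ω - sinCoeff.smulRight (profileVec 0)) (basisVec k)‖ ≤
      (1 - Real.cos ω) / (1 + Real.cos ω) := by
  have hT : (waveOp c 0 ω - sinCoeff.smulRight (profileVec 0)) (basisVec k) =
      ((1 - Real.cos ω) / (2 * (1 + Real.cos ω))) • (basisVec 1 + basisVec (-1)) := by
    rw [sub_apply, waveOp_basisVec, latticeOp_basisVec, h, ← mul_one_add]
    obtain rfl | rfl := eq_or_eq_neg_of_abs_eq hk <;>
      norm_num [sinCoeff_apply, basisVec_apply, profileVec] <;> match_scalars <;> field_simp <;>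
        ring
  have hcos1 := Real.cos_le_one ω
  calc _ ≤ ‖(1 - Real.cos ω) / (2 * (1 + Real.cos ω))‖ * (1 + 1) := by
        rw [hT, norm_smul]
        gcongr
        exact norm_add_le_of_le (norm_basisVec _).le (norm_basisVec _).le
    _ = (1 - Real.cos ω) / (1 + Real.cos ω) := by
        rw [Real.norm_of_nonneg (div_nonneg (by linarith) (by linarith))]
        field_simp
        norm_num

lemma norm_waveOp_sub_smulRight_basisVec_of_two_le {c ω : ℝ} (hcos : 0 < Real.cos ω)
    (h : c ^ 2 * ω ^ 2 = 2 + 2 * Real.cos ω) {k : ℤ} (hk : 2 ≤ |k|) :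
    ‖(waveOp c 0 ω - sinCoeff.smulRight (profileVec 0)) (basisVec k)‖ ≤
      1 / (1 + Real.cos ω) := by
  have hT : (waveOp c 0 ω - sinCoeff.smulRight (profileVec 0)) (basisVec k) =
      ((1 + Real.cos ω)⁻¹ * ((k : ℝ) ^ 2)⁻¹) •
        (basisVec k - Real.cos (k * ω) • basisVec (-k)) := by
    have h1 : 1 ≠ k := by rintro rfl; norm_num at hk
    have h2 : -1 ≠ k := by rintro rfl; norm_num at hk
    rw [sub_apply, waveOp_basisVec, latticeOp_basisVec, h, ← mul_one_add]
    simp only [ContinuousLinearMap.smulRight_apply, sinCoeff_apply, basisVec_apply, if_neg h1,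
      if_neg h2, mul_inv]
    module
  have hk2 : (4 : ℝ) ≤ (k : ℝ) ^ 2 := by
    have := sq_abs k ▸ pow_le_pow_left₀ zero_le_two hk 2
    exact_mod_cast this
  calc _ ≤ ‖(1 + Real.cos ω)⁻¹ * ((k : ℝ) ^ 2)⁻¹‖ * (1 + 1) := by
        rw [hT, norm_smul]
        gcongr
        refine norm_sub_le_of_le (norm_basisVec _).le ?_
        simpa [norm_smul, norm_basisVec] using Real.abs_cos_le_one _
    _ ≤ (1 + Real.cos ω)⁻¹ * 4⁻¹ * (1 + 1) := by
        rw [Real.norm_of_nonneg (by positivity)]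
        gcongr
    _ ≤ 1 / (1 + Real.cos ω) := by
        rw [one_div]
        linarith [inv_pos.2 (by linarith : 0 < 1 + Real.cos ω)]

lemma norm_waveOp_sub_smulRight_lt_one {c ω : ℝ} (hcos : 0 < Real.cos ω)
    (h : c ^ 2 * ω ^ 2 = 2 + 2 * Real.cos ω) :
    ‖waveOp c 0 ω - sinCoeff.smulRight (profileVec 0)‖ < 1 := by
  set κ := max ((1 - Real.cos ω) / (1 + Real.cos ω)) (1 / (1 + Real.cos ω))
  have hκ1 : κ < 1 := max_lt ((div_lt_one (by linarith)).2 (by linarith))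
    ((div_lt_one (by linarith)).2 (by linarith))
  have hκ0 : 0 ≤ κ := le_max_of_le_right (by positivity)
  refine (opNorm_le_of_basisVec _ hκ0 fun k => ?_).trans_lt hκ1
  obtain hk | hk | hk : |k| = 0 ∨ |k| = 1 ∨ 2 ≤ |k| := by have := abs_nonneg k; lia
  · obtain rfl := abs_eq_zero.1 hk
    simpa [waveOp_basisVec, sinCoeff_apply, basisVec_apply] using hκ0
  · exact (norm_waveOp_sub_smulRight_basisVec_of_abs_eq_one hcos h hk).trans (le_max_left _ _)
  · exact (norm_waveOp_sub_smulRight_basisVec_of_two_le hcos h hk).trans (le_max_right _ _)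

lemma hasFDerivAt_bifurcationMap {c ω : ℝ} (hω : ω ≠ 0) (h : c ^ 2 * ω ^ 2 = 2 + 2 * Real.cos ω)
    (hcos : 0 < Real.cos ω) :
    HasFDerivAt (fun y => bifurcationMap c ((0, 0), y)) (bordered sinCoeff (1 - waveOp c 0 ω)
      ((2 * (Real.sin ω + c ^ 2 * ω) / (c ^ 2 * ω ^ 2)) • profileVec 0)) (ω, profileVec 0) := by
  have hd : c ^ 2 * ω ^ 2 ≠ 0 := by rw [h]; positivity
  have hB : DifferentiableAt ℝ (waveOp c 0) ω :=
    ((contDiffAt_waveOp hd).comp ω (f := fun ω => (0, ω)) (by fun_prop)).differentiableAt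
      one_ne_zero
  have hg : HasDerivAt (fun ω => (2 + 2 * Real.cos ω) / (c ^ 2 * ω ^ 2))
      (-(2 * (Real.sin ω + c ^ 2 * ω) / (c ^ 2 * ω ^ 2))) ω := by
    refine ((((Real.hasDerivAt_cos ω).const_mul 2).const_add 2).fun_div
      ((hasDerivAt_pow 2 ω).const_mul (c ^ 2)) hd).congr_deriv ?_
    rw [← h]
    field_simp
    push_cast
    ring
  have := hasFDerivAt_normalized_eigenproblem (S := sinCoeff) hB (waveOp_profileVec_zero c) hg
  simpa only [bifurcationMap, zero_smul, add_zero, neg_neg] using this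

end Bifurcation

section Frequencies

lemma abs_cos_sub_cos_le (x y : ℝ) : |Real.cos x - Real.cos y| ≤ |x ^ 2 - y ^ 2| / 2 := by
  rw [Real.cos_sub_cos, abs_mul, abs_mul, abs_neg, abs_two]
  calc 2 * |Real.sin ((x + y) / 2)| * |Real.sin ((x - y) / 2)|
      ≤ 2 * |(x + y) / 2| * |(x - y) / 2| := by
        gcongr 2 * ?_ * ?_ <;> exact Real.abs_sin_le_abs
    _ = |x ^ 2 - y ^ 2| / 2 := by
        rw [mul_assoc, ← abs_mul, div_mul_div_comm, ← sq_sub_sq, abs_div]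
        norm_num
        ring

lemma abs_sqrt_sq_add_sq_sub_le (p q r : ℝ) :
    |√(p ^ 2 + q ^ 2) - √(p ^ 2 + r ^ 2)| ≤ |q - r| := by
  have h := abs_norm_sub_norm_le (⟨p, q⟩ : ℂ) ⟨p, r⟩
  simpa [Complex.norm_eq_sqrt_sq_add_sq, Real.sqrt_sq_eq_abs] using h

lemma abs_lambdaPlus_sub_le {μ : ℝ} (hμ : 0 ≤ 1 + μ) (x y : ℝ) :
    |lambdaPlus μ x - lambdaPlus μ y| ≤ √(1 + μ) * |x ^ 2 - y ^ 2| := by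
  have h (t : ℝ) : 4 * (1 + μ) * Real.cos t ^ 2 = (2 * √(1 + μ) * Real.cos t) ^ 2 := by
    rw [mul_pow, mul_pow, Real.sq_sqrt hμ]
    norm_num
  calc |lambdaPlus μ x - lambdaPlus μ y|
      ≤ |2 * √(1 + μ) * Real.cos x - 2 * √(1 + μ) * Real.cos y| := by
        simpa only [lambdaPlus, h, add_sub_add_left_eq_sub] using abs_sqrt_sq_add_sq_sub_le μ _ _
    _ = 2 * √(1 + μ) * |Real.cos x - Real.cos y| := by
        rw [← mul_sub, abs_mul, abs_of_nonneg (by positivity : 0 ≤ 2 * √(1 + μ))]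
    _ ≤ 2 * √(1 + μ) * (|x ^ 2 - y ^ 2| / 2) := by
        gcongr
        exact abs_cos_sub_cos_le x y
    _ = √(1 + μ) * |x ^ 2 - y ^ 2| := by ring

lemma isCriticalFrequency_unique {c μ x y : ℝ} (hμ : 0 ≤ 1 + μ) (hμc : 1 + μ < c ^ 4)
    (hx : IsCriticalFrequency c μ x) (hy : IsCriticalFrequency c μ y) : x = y := by
  have hsqrt : √(1 + μ) < c ^ 2 := (Real.sqrt_lt' (by nlinarith [sq_nonneg c])).2 (by linarith)
  have hle : c ^ 2 * |x ^ 2 - y ^ 2| ≤ √(1 + μ) * |x ^ 2 - y ^ 2| := by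
    refine le_of_eq_of_le ?_ (abs_lambdaPlus_sub_le hμ x y)
    rw [← hx.2, ← hy.2, ← mul_sub, abs_mul, abs_sq]
  have hzero : |x ^ 2 - y ^ 2| = 0 := by
    by_contra hne
    exact (mul_lt_mul_of_pos_right hsqrt ((abs_nonneg _).lt_of_ne' hne)).not_ge hle
  exact (sq_eq_sq₀ hx.1.le hy.1.le).1 (sub_eq_zero.1 (abs_eq_zero.1 hzero))

lemma criticalFrequency_eq {c μ ω : ℝ} (hμ : 0 ≤ 1 + μ) (hμc : 1 + μ < c ^ 4)
    (h : IsCriticalFrequency c μ ω) : criticalFrequency c μ = ω := by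
  have hset : {x | IsCriticalFrequency c μ x} = {ω} :=
    Set.eq_singleton_iff_unique_mem.2 ⟨h, fun _ hx => isCriticalFrequency_unique hμ hμc hx h⟩
  rw [criticalFrequency, hset, csInf_singleton]

lemma exists_mem_Ioo_mul_sq_eq {c b : ℝ} {g : ℝ → ℝ} (hb : 0 ≤ b) (hg : Continuous g)
    (h0 : 0 < g 0) (hgb : g b < c ^ 2 * b ^ 2) : ∃ ω ∈ Set.Ioo 0 b, c ^ 2 * ω ^ 2 = g ω := by
  have hcont : ContinuousOn (fun x => c ^ 2 * x ^ 2 - g x) (Set.Icc 0 b) := by fun_prop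
  obtain ⟨ω, hω, h⟩ := intermediate_value_Ioo hb hcont
    (⟨by simpa using h0, sub_pos.2 hgb⟩ : (0 : ℝ) ∈ Set.Ioo _ _)
  exact ⟨ω, hω, sub_eq_zero.1 h⟩

lemma lambdaPlus_le {μ : ℝ} (hμ : 0 ≤ 1 + μ) (x : ℝ) : lambdaPlus μ x ≤ 2 * (2 + μ) := by
  have h : √(μ ^ 2 + 4 * (1 + μ) * Real.cos x ^ 2) ≤ 2 + μ :=
    Real.sqrt_le_iff.2 ⟨by linarith, by nlinarith [Real.cos_sq_le_one x]⟩
  rw [lambdaPlus]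
  linarith

lemma exists_isCriticalFrequency {c μ : ℝ} (hc : 1 < c ^ 2) (hμ : 0 ≤ 1 + μ) :
    ∃ ω, IsCriticalFrequency c μ ω := by
  have hcont : Continuous (lambdaPlus μ) := by
    unfold lambdaPlus
    fun_prop
  have h0 : 0 < lambdaPlus μ 0 := add_pos_of_pos_of_nonneg (by linarith) (Real.sqrt_nonneg _)
  obtain ⟨ω, hω, h⟩ := exists_mem_Ioo_mul_sq_eq (c := c) (b := 2 * (2 + μ)) (by linarith) hcont h0
    ((lambdaPlus_le hμ _).trans_lt (by nlinarith))
  exact ⟨ω, hω.1, h⟩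

lemma exists_isFrequencyThreshold {c : ℝ} (hc : 1 < c ^ 2) : ∃ μω, IsFrequencyThreshold c μω := by
  have hc4 : 1 < c ^ 4 := by nlinarith
  refine ⟨min 1 ((c ^ 4 - 1) / 2), lt_min one_pos (by linarith), fun μ hμ => ?_⟩
  obtain ⟨hμ1, hμ2⟩ := le_min_iff.1 hμ
  have hμ0 : 0 ≤ 1 + μ := by linarith [neg_abs_le μ]
  have hμc : 1 + μ < c ^ 4 := by linarith [le_abs_self μ]
  obtain ⟨ω, hω⟩ := exists_isCriticalFrequency hc hμ0
  exact ⟨ω, hω, fun _ hx => isCriticalFrequency_unique hμ0 hμc hx hω⟩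

lemma exists_monatomic_frequency {c : ℝ} (hc : 1 < c ^ 2) :
    ∃ ω, 0 < ω ∧ 0 < Real.cos ω ∧ c ^ 2 * ω ^ 2 = 2 + 2 * Real.cos ω := by
  have hpi : 2 < c ^ 2 * (Real.pi / 2) ^ 2 := by nlinarith [Real.pi_gt_three]
  obtain ⟨ω, hω, h⟩ := exists_mem_Ioo_mul_sq_eq (g := fun x => 2 + 2 * Real.cos x)
    Real.pi_div_two_pos.le (by fun_prop) (by norm_num) (by simpa using hpi)
  exact ⟨ω, hω.1, Real.cos_pos_of_mem_Ioo ⟨by linarith [hω.1, Real.pi_pos], hω.2⟩, h⟩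

lemma abs_upsilon_le {c μ δ : ℝ} (hδ : 0 < δ) (h : δ ≤ upsilonDenom c μ) :
    |upsilon c μ| ≤ δ⁻¹ * |μ| := by
  rw [upsilon, abs_div, abs_mul, abs_of_pos (hδ.trans_le h), mul_comm δ⁻¹, ← div_eq_mul_inv]
  exact div_le_div₀ (abs_nonneg _)
    (mul_le_of_le_one_right (abs_nonneg _) (Real.abs_sin_le_one _)) hδ h

end Frequencies

section ZeroAmplitude

variable {c μ ω : ℝ} {u : Coeff}

lemma IsFourierSolution.apply_eq_zero (h : IsFourierSolution c μ 0 ω u) (hμ : |μ| ≤ 1)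
    (hd : 2 + μ < c ^ 2 * ω ^ 2) {k : ℤ} (hk : 2 ≤ |k|) : u k = 0 := by
  have hμ1 := neg_le_of_abs_le hμ
  have hbound (j : ℤ) : c ^ 2 * ω ^ 2 * j ^ 2 * |u j| ≤ (2 + μ) * (|u j| + |u (-j)|) + |u j| := by
    calc c ^ 2 * ω ^ 2 * j ^ 2 * |u j|
        = |(2 + μ) * (u j - Real.cos (j * ω) * u (-j)) + μ * (Real.sin (j * ω) * u j)| := by
          rw [← latticeOp_apply, ← abs_of_nonneg (by positivity : 0 ≤ c ^ 2 * ω ^ 2 * (j : ℝ) ^ 2),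
            ← abs_mul, h j, zero_smul, add_zero]
      _ ≤ |2 + μ| * (|u j| + |Real.cos (j * ω)| * |u (-j)|) +
          |μ| * (|Real.sin (j * ω)| * |u j|) := by
          rw [← abs_mul, ← abs_mul, ← abs_mul]
          refine (abs_add_le _ _).trans ?_
          rw [abs_mul (2 + μ)]
          gcongr
          exact abs_sub _ _
      _ ≤ (2 + μ) * (|u j| + 1 * |u (-j)|) + 1 * (1 * |u j|) := by
          rw [abs_of_pos (by linarith : 0 < 2 + μ)]
          gcongr
          exacts [by linarith, Real.abs_cos_le_one _, Real.abs_sin_le_one _]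
      _ = _ := by ring
  have hk2 : (4 : ℝ) ≤ (k : ℝ) ^ 2 := by
    have := sq_abs k ▸ pow_le_pow_left₀ zero_le_two hk 2
    exact_mod_cast this
  have h1 := hbound k
  have h2 := hbound (-k)
  push_cast at h2
  rw [neg_neg, neg_sq] at h2
  by_contra hne
  have hpos : 0 < |u k| + |u (-k)| := add_pos_of_pos_of_nonneg (abs_pos.2 hne) (abs_nonneg _)
  have hle : c ^ 2 * ω ^ 2 * k ^ 2 ≤ 2 * (2 + μ) + 1 :=
    le_of_mul_le_mul_right (by linarith) hpos
  have hge : (2 + μ) * 4 ≤ c ^ 2 * ω ^ 2 * k ^ 2 :=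
    mul_le_mul hd.le hk2 (by norm_num) (by positivity)
  linarith

lemma IsFourierSolution.dispersion (h : IsFourierSolution c μ 0 ω u) (hS : sinCoeff u = 1) :
    (u 1 + u (-1)) / 2 * (c ^ 2 * ω ^ 2 - (2 + μ) * (1 - Real.cos ω)) = μ * Real.sin ω ∧
      c ^ 2 * ω ^ 2 = (2 + μ) * (1 + Real.cos ω) + μ * Real.sin ω * ((u 1 + u (-1)) / 2) := by
  have h1 := h 1
  have h2 := h (-1)
  rw [zero_smul, add_zero, latticeOp_apply] at h1 h2
  rw [neg_neg] at h2
  norm_num at h1 h2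
  rw [sinCoeff_apply] at hS
  constructor
  · linear_combination (h1 + h2) / 2 + μ * Real.sin ω * hS
  · linear_combination (h1 - h2) / 2 - (c ^ 2 * ω ^ 2 - (2 + μ) * (1 + Real.cos ω)) * hS

lemma IsFourierSolution.eq_profileVec (h : IsFourierSolution c μ 0 ω u) (hμ : |μ| ≤ 1)
    (hd : 2 + μ < c ^ 2 * ω ^ 2) (hcos : 0 < Real.cos ω) (h0 : u 0 = 0) (hS : sinCoeff u = 1) :
    u = profileVec (μ * Real.sin ω / (c ^ 2 * ω ^ 2 - (2 + μ) * (1 - Real.cos ω))) := by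
  have hμ1 := neg_le_of_abs_le hμ
  have hD : c ^ 2 * ω ^ 2 - (2 + μ) * (1 - Real.cos ω) ≠ 0 := by
    have : 0 < (2 + μ) * Real.cos ω := mul_pos (by linarith) hcos
    linarith
  rw [← eq_div_of_mul_eq hD (h.dispersion hS).1]
  rw [sinCoeff_apply] at hS
  ext k
  rw [profileVec_apply]
  obtain hk | hk | hk : |k| = 0 ∨ |k| = 1 ∨ 2 ≤ |k| := by have := abs_nonneg k; lia
  · obtain rfl := abs_eq_zero.1 hk
    simp [h0]
  · obtain rfl | rfl := eq_or_eq_neg_of_abs_eq hk <;> norm_num <;> linarith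
  · have h1 : k ≠ 1 := by rintro rfl; norm_num at hk
    have h2 : k ≠ -1 := by rintro rfl; norm_num at hk
    simp [h1, h2, h.apply_eq_zero hμ hd hk]

lemma IsFourierSolution.isCriticalFrequency (h : IsFourierSolution c μ 0 ω u) (hω : 0 < ω)
    (hd : 2 + μ < c ^ 2 * ω ^ 2) (hS : sinCoeff u = 1) : IsCriticalFrequency c μ ω := by
  obtain ⟨h1, h2⟩ := h.dispersion hS
  have hsq : μ ^ 2 + 4 * (1 + μ) * Real.cos ω ^ 2 = (c ^ 2 * ω ^ 2 - (2 + μ)) ^ 2 := by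
    linear_combination (-(c ^ 2 * ω ^ 2 - (2 + μ) * (1 - Real.cos ω))) * h2
      - μ * Real.sin ω * h1 - μ ^ 2 * Real.sin_sq_add_cos_sq ω
  refine ⟨hω, ?_⟩
  rw [lambdaPlus, hsq, Real.sqrt_sq (by linarith)]
  ring

lemma IsFourierSolution.criticalFrequency_eq_and_upsilon (h : IsFourierSolution c μ 0 ω u)
    (hμ : |μ| ≤ 1) (hμc : 1 + μ < c ^ 4) (hω : 0 < ω) (hd : 2 + μ < c ^ 2 * ω ^ 2)
    (hcos : 0 < Real.cos ω) (h0 : u 0 = 0) (hS : sinCoeff u = 1) :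
    criticalFrequency c μ = ω ∧
      upsilonDenom c μ = c ^ 2 * ω ^ 2 - (2 + μ) * (1 - Real.cos ω) ∧
      profileVec (upsilon c μ) = u := by
  have hcrit := h.isCriticalFrequency hω hd hS
  have hfreq := criticalFrequency_eq (by linarith [neg_le_of_abs_le hμ]) hμc hcrit
  have hdenom : upsilonDenom c μ = c ^ 2 * ω ^ 2 - (2 + μ) * (1 - Real.cos ω) := by
    rw [upsilonDenom, hfreq, hcrit.2]
  refine ⟨hfreq, hdenom, ?_⟩
  rw [h.eq_profileVec hμ hd hcos h0 hS, upsilon, hdenom, hfreq]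

end ZeroAmplitude

section Branch

lemma of_bifurcationMap_eq_zero {c μ a ω : ℝ} {u : Coeff} (hd : c ^ 2 * ω ^ 2 ≠ 0)
    (h : bifurcationMap c ((μ, a), ω, u) = 0) :
    IsFourierSolution c μ a ω u ∧ u 0 = 0 ∧ sinCoeff u = 1 := by
  obtain ⟨hS, hu⟩ := Prod.mk_eq_zero.1 h
  rw [sub_eq_zero] at hS hu
  exact ⟨isFourierSolution_of_eq_waveOp hd hu, apply_zero_of_eq_waveOp hu, hS⟩

lemma exists_local_branch {c ω : ℝ} (hc : 1 < c ^ 2) (hω : 0 < ω) (hcos : 0 < Real.cos ω)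
    (h : c ^ 2 * ω ^ 2 = 2 + 2 * Real.cos ω) :
    ∃ ψ : ℝ × ℝ → ℝ × Coeff, (∃ K, ∃ s ∈ nhds 0, LipschitzOnWith K ψ s) ∧
      Filter.Tendsto ψ (nhds 0) (nhds (ω, profileVec 0)) ∧
      ∀ᶠ x in nhds 0, bifurcationMap c (x, ψ x) = 0 := by
  have hd : c ^ 2 * ω ^ 2 ≠ 0 := by positivity
  have heig : waveOp c 0 ω (profileVec 0) = profileVec 0 := by
    rw [waveOp_profileVec_zero, ← h, div_self hd, one_smul]
  have htransversal : 2 * (Real.sin ω + c ^ 2 * ω) / (c ^ 2 * ω ^ 2) ≠ 0 := by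
    have := neg_le_of_abs_le (Real.abs_sin_le_abs.trans_eq (abs_of_pos hω))
    exact div_ne_zero (by nlinarith) hd
  have hinv := isInvertible_bordered (S := sinCoeff) (A := 1 - waveOp c 0 ω)
    (sub_eq_zero.2 heig.symm) (sinCoeff_profileVec 0) htransversal <| by
      rw [sub_add]
      exact isUnit_one_sub_of_norm_lt_one (norm_waveOp_sub_smulRight_lt_one hcos h)
  have hbase : bifurcationMap c (0, ω, profileVec 0) = 0 := by
    simp [bifurcationMap, heig, sinCoeff_profileVec]
  simpa only [Prod.mk_zero_zero, hbase] using
    exists_lipschitz_implicit (contDiffAt_bifurcationMap hd 0 0 (profileVec 0))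
      (hasFDerivAt_bifurcationMap hω.ne' h hcos) hinv

lemma exists_branch {c m : ℝ} (hc : 1 < c ^ 2) (hm : 0 < m) :
    ∃ ε ∈ Set.Ioo 0 m, ∃ δ > 0, ∃ (K : ℝ≥0) (ψ : ℝ × ℝ → ℝ × Coeff),
      LipschitzOnWith K ψ (Metric.closedBall 0 ε) ∧
      (∀ x ∈ Metric.closedBall 0 ε, IsFourierSolution c x.1 x.2 (ψ x).1 (ψ x).2) ∧
      ∀ μ : ℝ, |μ| ≤ ε → δ ≤ upsilonDenom c μ ∧
        ψ (μ, 0) = (criticalFrequency c μ, profileVec (upsilon c μ)) := by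
  obtain ⟨ω₀, hω₀, hcos₀, h⟩ := exists_monatomic_frequency hc
  obtain ⟨ψ, ⟨K, s, hs, hLip⟩, htend, hzero⟩ := exists_local_branch hc hω₀ hcos₀ h
  have hev (g : ℝ → ℝ → ℝ) (hg : Continuous (Function.uncurry g)) (h0 : 0 < g 0 ω₀) :
      ∀ᶠ x in nhds (0 : ℝ × ℝ), 0 < g x.1 (ψ x).1 :=
    ((continuous_fst.tendsto (0 : ℝ × ℝ)).prodMk_nhds
      ((continuous_fst.tendsto _).comp htend)).eventually
        (hg.continuousAt.eventually (lt_mem_nhds h0))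
  have hω := hev (fun _ ω => ω) (by fun_prop) hω₀
  have hcos := hev (fun _ ω => Real.cos ω) (by fun_prop) hcos₀
  have hd := hev (fun μ ω => c ^ 2 * ω ^ 2 - (2 + μ) - Real.cos ω₀) (by fun_prop) (by linarith)
  have hμ := hev (fun μ _ => 1 - |μ|) (by fun_prop) (by norm_num)
  have hμc := hev (fun μ _ => c ^ 4 - (1 + μ)) (by fun_prop) (by nlinarith)
  obtain ⟨ε₀, hε₀, hball₀⟩ := Metric.nhds_basis_closedBall.eventually_iff.1
    (hzero.and <| hω.and <| hcos.and <| hd.and <| hμ.and <| hμc.and hs)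
  obtain ⟨ε, hε, hεm⟩ := exists_between (lt_min hε₀ hm)
  have hball {x} (hx : x ∈ Metric.closedBall 0 ε) :=
    hball₀ (Metric.closedBall_subset_closedBall (hεm.le.trans (min_le_left _ _)) hx)
  refine ⟨ε, ⟨hε, hεm.trans_le (min_le_right _ _)⟩, Real.cos ω₀, hcos₀, K, ψ,
    hLip.mono fun x hx => (hball hx).2.2.2.2.2.2, fun x hx => ?_, fun μ hμ => ?_⟩
  · obtain ⟨h0, -, -, hd, hμ, -⟩ := hball hx
    refine (of_bifurcationMap_eq_zero ?_ h0).1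
    exact (by linarith [neg_abs_le x.1] : 0 < c ^ 2 * (ψ x).1 ^ 2).ne'
  · obtain ⟨h0, hω, hcos, hd, hμ, hμc, -⟩ :=
      hball (x := (μ, 0)) (mem_closedBall_zero_iff.2 (max_le hμ (by simpa using hε.le)))
    have hμ0 : -1 < μ := by linarith [neg_abs_le μ]
    obtain ⟨hsol, hmean, hS⟩ := of_bifurcationMap_eq_zero (by positivity) h0
    obtain ⟨hfreq, hdenom, hu⟩ := hsol.criticalFrequency_eq_and_upsilon (by linarith) (by linarith)
      hω (by linarith) hcos hmean hS
    have hpos : 0 < (2 + μ) * Real.cos (ψ (μ, 0)).1 := mul_pos (by linarith) hcos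
    exact ⟨by rw [hdenom]; linarith, by rw [hfreq, hu]⟩

end Branch

section Profiles

lemma exists_sobolevInftyNorm_evenPart_add_oddPart_le (r : ℕ) : ∃ C > 0, ∀ ω ω' p p',
    ENNReal.ofReal |ω - ω'| + sobolevInftyNorm r (evenPart p - evenPart p') +
      sobolevInftyNorm r (oddPart p - oddPart p') ≤ ENNReal.ofReal (C * ‖(ω, p) - (ω', p')‖) := by
  obtain ⟨C₁, h₁⟩ := exists_sobolevInftyNorm_clm_fourierEval_le Complex.reCLM r
  obtain ⟨C₂, h₂⟩ := exists_sobolevInftyNorm_clm_fourierEval_le Complex.imCLM r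
  refine ⟨1 + C₁ + C₂, by positivity, fun ω ω' p p' => ?_⟩
  calc _ ≤ ENNReal.ofReal |ω - ω'| + ENNReal.ofReal (C₁ * ‖p - p'‖) +
        ENNReal.ofReal (C₂ * ‖p - p'‖) := by
        rw [← map_sub, ← map_sub]
        exact add_le_add (add_le_add le_rfl (h₁ _)) (h₂ _)
    _ = ENNReal.ofReal (|ω - ω'| + C₁ * ‖p - p'‖ + C₂ * ‖p - p'‖) := by
        rw [ENNReal.ofReal_add (by positivity) (by positivity),
          ENNReal.ofReal_add (by positivity) (by positivity)]
    _ ≤ ENNReal.ofReal ((1 + C₁ + C₂) * ‖(ω, p) - (ω', p')‖) := by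
        rw [add_mul, add_mul, one_mul]
        gcongr
        exacts [norm_fst_le (ω - ω', p - p'), norm_snd_le (ω - ω', p - p'),
          norm_snd_le (ω - ω', p - p')]

end Profiles

end DiatomicFPUT

end

open DiatomicFPUT

theorem proposition3p2 (c : ℝ) (hc : 1 < |c|) :
    (∃ μω : ℝ, DiatomicFPUT.IsFrequencyThreshold c μω) ∧
    ∀ μω : ℝ, DiatomicFPUT.IsFrequencyThreshold c μω →
      ∃ μper aper : ℝ, 0 < μper ∧ μper < min μω 1 ∧ 0 < aper ∧
        -- `υ_c^μ` is well defined and `O_c(μ)`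
        (∀ μ : ℝ, |μ| ≤ μper → DiatomicFPUT.upsilonDenom c μ ≠ 0) ∧
        (∃ C : ℝ, 0 < C ∧ ∀ μ : ℝ, |μ| ≤ μper → |DiatomicFPUT.upsilon c μ| ≤ C * |μ|) ∧
        -- the maps `ω_c^μ[a]`, `ψ_{c,1}^μ[a]`, `ψ_{c,2}^μ[a]`, as functions of `μ` and `a`
        ∃ (ω : ℝ → ℝ → ℝ) (ψ₁ ψ₂ : ℝ → ℝ → ℝ → ℝ),
          (∀ μ a : ℝ, |μ| ≤ μper → |a| ≤ aper →
            (DiatomicFPUT.IsSmoothPeriodic (ψ₁ μ a) ∧ Function.Even (ψ₁ μ a)) ∧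
            (DiatomicFPUT.IsSmoothPeriodic (ψ₂ μ a) ∧ Function.Odd (ψ₂ μ a)) ∧
            DiatomicFPUT.travelingWaveOp c
              (a • DiatomicFPUT.periodicProfile (DiatomicFPUT.upsilon c μ) (ω μ a)
                (ψ₁ μ a) (ψ₂ μ a)) μ = 0) ∧
          (∀ μ : ℝ, |μ| ≤ μper →
            ω μ 0 = DiatomicFPUT.criticalFrequency c μ ∧ ψ₁ μ 0 = 0 ∧ ψ₂ μ 0 = 0) ∧
          ∀ r : ℕ, ∃ C : ℝ, 0 < C ∧ ∀ μ a a' : ℝ, |μ| ≤ μper → |a| ≤ aper → |a'| ≤ aper →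
            ENNReal.ofReal |ω μ a - ω μ a'|
              + DiatomicFPUT.sobolevInftyNorm r (ψ₁ μ a - ψ₁ μ a')
              + DiatomicFPUT.sobolevInftyNorm r (ψ₂ μ a - ψ₂ μ a')
              ≤ ENNReal.ofReal (C * |a - a'|) := by
  have hc2 : 1 < c ^ 2 := (one_lt_sq_iff_one_lt_abs c).2 hc
  refine ⟨exists_isFrequencyThreshold hc2, fun μω hμω => ?_⟩
  obtain ⟨ε, ⟨hε, hεm⟩, δ, hδ, K, u, hLip, hsol, hzero⟩ :=
    exists_branch hc2 (lt_min hμω.1 one_pos)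
  have hbox {μ a : ℝ} (hμ : |μ| ≤ ε) (ha : |a| ≤ ε) : (μ, a) ∈ Metric.closedBall 0 ε :=
    mem_closedBall_zero_iff.2 (max_le hμ ha)
  refine ⟨ε, ε, hε, hεm, hε, fun μ hμ => (hδ.trans_le (hzero μ hμ).1).ne',
    ⟨δ⁻¹, inv_pos.2 hδ, fun μ hμ => abs_upsilon_le hδ (hzero μ hμ).1⟩, fun μ a => (u (μ, a)).1,
    fun μ a => evenPart ((u (μ, a)).2 - profileVec (upsilon c μ)),
    fun μ a => oddPart ((u (μ, a)).2 - profileVec (upsilon c μ)),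
    fun μ a hμ ha => ⟨⟨isSmoothPeriodic_evenPart _, even_evenPart _⟩,
      ⟨isSmoothPeriodic_oddPart _, odd_oddPart _⟩, ?_⟩,
    fun μ hμ => by simp only [(hzero μ hμ).2, sub_self, map_zero, and_self], fun r => ?_⟩
  · rw [← toProfile_profileVec_add, add_sub_cancel]
    exact (hsol _ (hbox hμ ha)).travelingWaveOp_eq_zero
  · obtain ⟨C, hC, hr⟩ := exists_sobolevInftyNorm_evenPart_add_oddPart_le r
    refine ⟨C * (K + 1), by positivity, fun μ a a' hμ ha ha' => (hr _ _ _ _).trans ?_⟩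
    have hdist := hLip.dist_le_mul _ (hbox hμ ha) _ (hbox hμ ha')
    rw [dist_eq_norm, dist_prod_same_left, Real.dist_eq] at hdist
    rw [Prod.mk_sub_mk, sub_sub_sub_cancel_right, mul_assoc]
    gcongr
    exact hdist.trans (by gcongr; simp)
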